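/- Let $X$ be the graph with vertex set $\mathbb{Z}^2$ in which two vertices are joined by an edge if and only if their $\ell^1$-distance is one. The vertex boundary $\partial A$ of a set $A\subset\mathbb{Z}^2$ is the set of vertices not in $A$ that are adjacent to a vertex of $A$. A set $A$ is minimal if $|\partial A|\le|\partial B|$ for every $B\subset\mathbb{Z}^2$ with $|B|=|A|$. Two sets are congruent if some graph automorphism of $X$ maps one onto the other. A set $A$ is uniquely minimal if it is minimal and every minimal set with the same number of vertices as $A$ is congruent to $A$. For $\alpha,\beta\in\mathbb{N}=\{0,1,2,\dots\}$ let $B(\alpha,\beta)$ be the set of all $(x,y)\in\mathbb{Z}^2$ with $0\le y-x\le\alpha$ and $0\le y+x\le\beta$. Theorem. A finite non-empty subset of $\mathbb{Z}^2$ is uniquely minimal if and only if it is congruent to $B(2n,2n)$ or to $B(n,n+1)$ for some $n\in\mathbb{N}$. -/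

import Mathlib

/-- The graph with vertex set `ℤ × ℤ` in which two vertices are adjacent exactly when their
`ℓ¹`-distance is one. -/
def latticeGraph : SimpleGraph (ℤ × ℤ) where
  Adj p q := |p.1 - q.1| + |p.2 - q.2| = 1
  symm := ⟨fun p q h => by rw [abs_sub_comm q.1 p.1, abs_sub_comm q.2 p.2]; exact h⟩
  loopless := ⟨fun p h => by simp at h⟩

/-- The vertex boundary of a set of vertices: the vertices outside the set that are adjacent to
a vertex of the set. -/
def vertexBoundary {V : Type*} (G : SimpleGraph V) (A : Set V) : Set V :=
  {u | u ∉ A ∧ ∃ v ∈ A, G.Adj u v}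

/-- A set of vertices is minimal if its vertex boundary is smallest among those of all sets with
the same number of vertices. -/
def IsMinimalSet {V : Type*} (G : SimpleGraph V) (A : Set V) : Prop :=
  ∀ B : Set V, B.encard = A.encard → (vertexBoundary G A).encard ≤ (vertexBoundary G B).encard

/-- Two sets of vertices are congruent if a graph automorphism maps the first onto the second. -/
def CongruentSets {V : Type*} (G : SimpleGraph V) (A B : Set V) : Prop :=
  ∃ φ : G ≃g G, φ '' A = B

/-- A set is uniquely minimal if it is minimal and every minimal set with the same number of
vertices is congruent to it. -/
def IsUniquelyMinimal {V : Type*} (G : SimpleGraph V) (A : Set V) : Prop :=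
  IsMinimalSet G A ∧
    ∀ B : Set V, IsMinimalSet G B → B.encard = A.encard → CongruentSets G B A

/-- The box `B(α, β)`: the vertices `(x, y)` with `0 ≤ y - x ≤ α` and `0 ≤ y + x ≤ β`. -/
def latticeBox (α β : ℕ) : Set (ℤ × ℤ) :=
  {p | 0 ≤ p.2 - p.1 ∧ p.2 - p.1 ≤ (α : ℤ) ∧ 0 ≤ p.2 + p.1 ∧ p.2 + p.1 ≤ (β : ℤ)}

/-!
In the coordinates `(y - x, y + x)` the neighbourhood of a nonempty finite set `S` is, up to
translation, the sumset `S + {0, (2, 0)} + {0, (0, 2)}`, so it has at least `|S| + σ(S) + 1`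
points, where `σ(S)` is the sum of the sizes of the two coordinate projections of `S`. Neighbours
have opposite parity; applying this bound to the even part and the odd part of `A`, together with
`4 |S| ≤ σ(S) ^ 2`, gives `8 |A| ≤ (|∂A| - 2) ^ 2 + 4`. Near equality forces both parts to be
products of arithmetic progressions of step two that interleave, so that `A` is a box, and the
number of its points determines its side lengths. For every size that does not belong to one of
the two families, two boxes of different diameter with part of a side removed are both minimal.
-/

open Finset
open scoped Pointwise

/-! ### Sumsets with a two-point set -/

theorem card_add_card_image_le_card_add_pair {G ι κ : Type*} [AddZeroClass G] [DecidableEq G]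
    [DecidableEq ι] [LinearOrder κ] {f : G → ι} {g : G → κ} {a : G} (S : Finset G)
    (hf : ∀ x, f (x + a) = f x) (hg : ∀ x, g x < g (x + a)) :
    #S + #(S.image f) ≤ #(S + {0, a}) := by
  have hS : S ⊆ S + {0, a} := fun x hx => mem_add.2 ⟨x, hx, 0, by simp, add_zero x⟩
  have hnew : S.image f ⊆ ((S + {0, a}) \ S).image f := by
    intro i hi
    obtain ⟨y, hy, rfl⟩ := mem_image.1 hi
    -- In each fibre of `f` the point `x` with `g x` maximal produces the new point `x + a`.
    obtain ⟨x, hx, hmax⟩ := exists_max_image {x ∈ S | f x = f y} g ⟨y, by simp [hy]⟩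
    obtain ⟨hxS, hxy⟩ := mem_filter.1 hx
    have hxa : x + a ∉ S := fun h =>
      (hg x).not_ge (hmax _ (mem_filter.2 ⟨h, (hf x).trans hxy⟩))
    exact mem_image.2
      ⟨x + a, mem_sdiff.2 ⟨add_mem_add hxS (by simp), hxa⟩, (hf x).trans hxy⟩
  calc #S + #(S.image f) ≤ #S + #((S + {0, a}) \ S) := by
        gcongr; exact (card_le_card hnew).trans card_image_le
    _ = #(S + {0, a}) := by rw [add_comm, card_sdiff_add_card_eq_card hS]

theorem card_add_card_image_add_card_image_add_pair_le {G M N : Type*} [AddMonoid G]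
    [DecidableEq G] [AddCommMonoid M] [LinearOrder M] [IsOrderedCancelAddMonoid M]
    [AddCommMonoid N] [LinearOrder N] [IsOrderedCancelAddMonoid N] (f : G →+ M) (g : G →+ N)
    {a b : G} (S : Finset G) (hfa : f a = 0) (hga : 0 < g a) (hgb : g b = 0) (hfb : 0 < f b) :
    #S + #(S.image f) + #(S.image g + {0, g a}) ≤ #(S + {0, a} + {0, b}) := by
  have hg : (S + {0, a}).image g = S.image g + {0, g a} := by
    simp only [image_add, image_insert, image_singleton, map_zero]
  calc #S + #(S.image f) + #(S.image g + {0, g a})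
      ≤ #(S + {0, a}) + #((S + {0, a}).image g) := by
        rw [hg]
        gcongr
        exact card_add_card_image_le_card_add_pair (g := g) S (by simp [hfa]) (by simp [hga])
    _ ≤ #(S + {0, a} + {0, b}) :=
        card_add_card_image_le_card_add_pair (g := f) _ (by simp [hgb]) (by simp [hfb])

theorem card_add_one_le_card_add_pair {M : Type*} [AddMonoid M] [LinearOrder M]
    [IsCancelAdd M] [AddLeftMono M] [AddRightMono M] {r : M} {I : Finset M} (hr : r ≠ 0)
    (hI : I.Nonempty) :
    #I + 1 ≤ #(I + {0, r}) := by
  simpa [card_pair hr.symm] using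
    cauchy_davenport_add_of_linearOrder_isCancelAdd hI (insert_nonempty 0 {r})

theorem add_mem_of_card_add_pair_le {G : Type*} [AddZeroClass G] [IsRightCancelAdd G]
    [DecidableEq G] {I : Finset G} {r x y : G} (h : #(I + {0, r}) ≤ #I + 1) (hy : y ∈ I)
    (hyr : y + r ∉ I) (hx : x ∈ I) (hxy : x ≠ y) : x + r ∈ I := by
  have hsub : I ⊆ I + {0, r} := fun z hz => mem_add.2 ⟨z, hz, 0, by simp, add_zero z⟩
  have hnew : #((I + {0, r}) \ I) ≤ 1 := by rw [card_sdiff_of_subset hsub]; omega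
  by_contra hxr
  exact hxy <| add_right_cancel <| card_le_one.1 hnew
    _ (mem_sdiff.2 ⟨add_mem_add hx (by simp), hxr⟩) _ (mem_sdiff.2 ⟨add_mem_add hy (by simp), hyr⟩)

theorem eq_image_range_of_card_add_pair_le {I : Finset ℤ} {r : ℤ} (hr : 0 < r) (hI : I.Nonempty)
    (h : #(I + {0, r}) ≤ #I + 1) : ∃ m, I = (range #I).image fun i : ℕ => m + r * i := by
  set M := I.max' hI
  have hMr : M + r ∉ I := fun hmem => by linarith [I.le_max' _ hmem]
  have hsucc : ∀ x ∈ I, x ≠ M → x + r ∈ I := fun x hx =>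
    add_mem_of_card_add_pair_le h (I.max'_mem hI) hMr hx
  have hmul : ∀ x ∈ I, ∀ n : ℕ, x + r * n ≤ M → x + r * n ∈ I := by
    intro x hx n
    induction n with
    | zero => simpa using fun _ => hx
    | succ n ih =>
      intro hn
      push_cast at hn ⊢
      rw [mul_add_one, ← add_assoc] at hn ⊢
      exact hsucc _ (ih (by linarith)) (by linarith)
  have hdvd : ∀ x ∈ I, ∃ n : ℕ, x + r * n = M := by
    intro x hx
    have hn : (0 : ℤ) ≤ (M - x) / r := Int.ediv_nonneg (sub_nonneg.2 (I.le_max' x hx)) hr.le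
    have hrem := Int.emod_add_mul_ediv (M - x) r
    have hlt := Int.emod_lt_of_pos (M - x) hr
    have hnonneg := Int.emod_nonneg (M - x) hr.ne'
    lift (M - x) / r to ℕ using hn with n
    refine ⟨n, by_contra fun hne => ?_⟩
    have := I.le_max' _ (hsucc _ (hmul x hx n (by linarith)) hne)
    linarith
  obtain ⟨n, hn⟩ := hdvd _ (I.min'_mem hI)
  have hIn : I = (range (n + 1)).image fun i : ℕ => I.min' hI + r * i := by
    ext x
    simp only [mem_image, mem_range]
    constructor
    · intro hx
      obtain ⟨i, hi⟩ := hdvd x hx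
      have hin : (i : ℤ) ≤ n := by nlinarith [I.min'_le x hx]
      exact ⟨n - i, by omega, by push_cast [Nat.cast_le.1 hin]; linarith⟩
    · rintro ⟨i, hi, rfl⟩
      exact hmul _ (I.min'_mem hI) i (by nlinarith)
  have hcard : #I = n + 1 := by
    rw [hIn, card_image_of_injective _ fun i j hij => ?_, card_range]
    simpa [hr.ne'] using hij
  exact ⟨I.min' hI, by rwa [hcard]⟩

theorem exists_union_eq_Ico {I J : Finset ℤ} (hI : I.Nonempty) (hJ : J.Nonempty)
    (hI2 : #(I + {0, 2}) ≤ #I + 1) (hJ2 : #(J + {0, 2}) ≤ #J + 1)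
    (hIJ : ∀ k ∈ I, k - 1 ∈ J ∨ k + 1 ∈ J) (hJI : ∀ k ∈ J, k - 1 ∈ I ∨ k + 1 ∈ I) :
    ∃ u : ℤ, I ∪ J = Ico u (u + (#I + #J : ℕ)) := by
  obtain ⟨m, hm⟩ := eq_image_range_of_card_add_pair_le two_pos hI hI2
  obtain ⟨n, hn⟩ := eq_image_range_of_card_add_pair_le two_pos hJ hJ2
  have hp := hI.card_pos
  have hq := hJ.card_pos
  have mem_I (k : ℤ) : k ∈ I ↔ m ≤ k ∧ k < m + 2 * #I ∧ 2 ∣ k - m := by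
    rw [Finset.ext_iff.1 hm k]
    simp only [mem_image, mem_range]
    exact ⟨by omega, fun h => ⟨((k - m) / 2).toNat, by omega⟩⟩
  have mem_J (k : ℤ) : k ∈ J ↔ n ≤ k ∧ k < n + 2 * #J ∧ 2 ∣ k - n := by
    rw [Finset.ext_iff.1 hn k]
    simp only [mem_image, mem_range]
    exact ⟨by omega, fun h => ⟨((k - n) / 2).toNat, by omega⟩⟩
  simp only [mem_I, mem_J] at hIJ hJI
  have := hIJ m (by omega)
  have := hIJ (m + 2 * #I - 2) (by omega)
  have := hJI n (by omega)
  have := hJI (n + 2 * #J - 2) (by omega)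
  refine ⟨min m n, ?_⟩
  ext k
  simp only [mem_union, mem_Ico, mem_I, mem_J]
  omega

/-! ### Rotated coordinates and parity classes -/

/-- The first rotated coordinate `y - x` of a vertex `(x, y)`. -/
def coordDiff : ℤ × ℤ →+ ℤ :=
  AddMonoidHom.mk' (fun p => p.2 - p.1) fun p q => add_sub_add_comm p.2 q.2 p.1 q.1

/-- The second rotated coordinate `y + x` of a vertex `(x, y)`. -/
def coordSum : ℤ × ℤ →+ ℤ :=
  AddMonoidHom.mk' (fun p => p.2 + p.1) fun p q => add_add_add_comm p.2 q.2 p.1 q.1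

/-- The rotated coordinates `(y - x, y + x)` of a vertex `(x, y)`. They turn the boxes `B(α, β)`
into rectangles with sides parallel to the axes. -/
def rotate : ℤ × ℤ →+ ℤ × ℤ := coordDiff.prod coordSum

@[simp] theorem coordDiff_apply (p : ℤ × ℤ) : coordDiff p = p.2 - p.1 := rfl

@[simp] theorem coordSum_apply (p : ℤ × ℤ) : coordSum p = p.2 + p.1 := rfl

theorem rotate_apply (p : ℤ × ℤ) : rotate p = (coordDiff p, coordSum p) := rfl

theorem rotate_injective : Function.Injective rotate := by
  rintro ⟨x, y⟩ ⟨x', y'⟩ h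
  simp only [rotate_apply, coordDiff_apply, coordSum_apply, Prod.mk.injEq] at h ⊢
  omega

theorem even_coordDiff_iff (p : ℤ × ℤ) : Even (coordDiff p) ↔ Even (coordSum p) := by
  simp only [coordDiff_apply, coordSum_apply, Int.even_sub, Int.even_add]

theorem latticeGraph_adj_iff {p q : ℤ × ℤ} : latticeGraph.Adj p q ↔
    (coordDiff q = coordDiff p - 1 ∨ coordDiff q = coordDiff p + 1) ∧
      (coordSum q = coordSum p - 1 ∨ coordSum q = coordSum p + 1) := by
  simp only [latticeGraph, coordDiff_apply, coordSum_apply]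
  grind

theorem even_coordSum_iff_of_adj {p q : ℤ × ℤ} (h : latticeGraph.Adj p q) :
    Even (coordSum q) ↔ ¬Even (coordSum p) := by
  have := (latticeGraph_adj_iff.1 h).2
  grind

/-- The vertices adjacent to some vertex of `A`, written as a sumset so that sumset estimates
apply to it. -/
def neighborSumset (A : Finset (ℤ × ℤ)) : Finset (ℤ × ℤ) :=
  A + {(0, 1), (0, -1), (1, 0), (-1, 0)}

theorem mem_neighborSumset {A : Finset (ℤ × ℤ)} {p : ℤ × ℤ} :
    p ∈ neighborSumset A ↔ ∃ q ∈ A, latticeGraph.Adj p q := by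
  have step {x y : ℤ × ℤ} (q : ℤ × ℤ) : q + x = y ↔ x = y - q := by rw [eq_sub_iff_add_eq']
  simp only [neighborSumset, mem_add, step, exists_eq_right]
  refine exists_congr fun q => and_congr_right fun _ => ?_
  simp only [latticeGraph, mem_insert, mem_singleton, Prod.ext_iff, Prod.fst_sub, Prod.snd_sub]
  grind

theorem vertexBoundary_coe (A : Finset (ℤ × ℤ)) :
    vertexBoundary latticeGraph ↑A = ↑(neighborSumset A \ A) := by
  ext p
  simp [vertexBoundary, mem_neighborSumset, and_comm]

/-- The sum of the sizes of the two rotated coordinate projections of `S`, that is, the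
semiperimeter of its shadow. -/
def semiperimeter (S : Finset (ℤ × ℤ)) : ℕ := #(S.image coordDiff) + #(S.image coordSum)

theorem image_rotate_subset (S : Finset (ℤ × ℤ)) :
    S.image rotate ⊆ S.image coordDiff ×ˢ S.image coordSum := by
  grind [rotate_apply]

theorem card_le_card_image_mul_card_image (S : Finset (ℤ × ℤ)) :
    #S ≤ #(S.image coordDiff) * #(S.image coordSum) := by
  rw [← card_product, ← card_image_of_injective S rotate_injective]
  exact card_le_card (image_rotate_subset S)

theorem mem_of_mem_image_of_card_eq {S : Finset (ℤ × ℤ)}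
    (hS : #S = #(S.image coordDiff) * #(S.image coordSum)) {p : ℤ × ℤ}
    (hd : coordDiff p ∈ S.image coordDiff) (hs : coordSum p ∈ S.image coordSum) : p ∈ S := by
  have himage : S.image rotate = S.image coordDiff ×ˢ S.image coordSum :=
    eq_of_subset_of_card_le (image_rotate_subset S) <| by
      rw [card_product, card_image_of_injective S rotate_injective, hS]
  rw [← rotate_injective.mem_finset_image, himage]
  exact mem_product.2 ⟨hd, hs⟩

theorem neighborSumset_eq (S : Finset (ℤ × ℤ)) :
    neighborSumset S = {(0, -1)} + (S + {0, (-1, 1)} + {0, (1, 1)}) := by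
  have hunit : ({(0, 1), (0, -1), (1, 0), (-1, 0)} : Finset (ℤ × ℤ)) =
      {(0, -1)} + ({0, (-1, 1)} + {0, (1, 1)}) := by decide
  rw [neighborSumset, hunit, add_left_comm S, ← add_assoc S]

theorem card_add_card_image_coordDiff_le (S : Finset (ℤ × ℤ)) :
    #S + #(S.image coordSum) + #(S.image coordDiff + {0, 2}) ≤ #(neighborSumset S) := by
  rw [neighborSumset_eq, card_singleton_add]
  have h2 : coordDiff (-1, 1) = 2 := rfl
  rw [← h2]
  exact card_add_card_image_add_card_image_add_pair_le coordSum coordDiff S rfl two_pos rfl two_pos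

theorem card_add_card_image_coordSum_le (S : Finset (ℤ × ℤ)) :
    #S + #(S.image coordDiff) + #(S.image coordSum + {0, 2}) ≤ #(neighborSumset S) := by
  rw [neighborSumset_eq, card_singleton_add, add_right_comm S]
  have h2 : coordSum (1, 1) = 2 := rfl
  rw [← h2]
  exact card_add_card_image_add_card_image_add_pair_le coordDiff coordSum S rfl two_pos rfl two_pos

theorem card_add_semiperimeter_lt_card_neighborSumset {S : Finset (ℤ × ℤ)} (hS : S.Nonempty) :
    #S + semiperimeter S < #(neighborSumset S) := by
  have h1 := card_add_one_le_card_add_pair (two_ne_zero (α := ℤ)) (hS.image coordSum)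
  have h2 := card_add_card_image_coordSum_le S
  unfold semiperimeter
  omega

/-- The vertices `(x, y)` of `A` with `y + x` even. -/
def evenPart (A : Finset (ℤ × ℤ)) : Finset (ℤ × ℤ) := {p ∈ A | Even (coordSum p)}

/-- The vertices `(x, y)` of `A` with `y + x` odd. -/
def oddPart (A : Finset (ℤ × ℤ)) : Finset (ℤ × ℤ) := {p ∈ A | ¬Even (coordSum p)}

theorem card_evenPart_add_card_oddPart (A : Finset (ℤ × ℤ)) : #(evenPart A) + #(oddPart A) = #A :=
  card_filter_add_card_filter_not _

theorem card_neighborSumset_sdiff (A : Finset (ℤ × ℤ)) :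
    #(neighborSumset A \ A) = #(neighborSumset (evenPart A) \ oddPart A) +
      #(neighborSumset (oddPart A) \ evenPart A) := by
  have heven : evenPart (neighborSumset A \ A) = neighborSumset (oddPart A) \ evenPart A := by
    ext p
    simp only [evenPart, oddPart, mem_filter, mem_sdiff, mem_neighborSumset]
    grind [even_coordSum_iff_of_adj]
  have hodd : oddPart (neighborSumset A \ A) = neighborSumset (evenPart A) \ oddPart A := by
    ext p
    simp only [evenPart, oddPart, mem_filter, mem_sdiff, mem_neighborSumset]
    grind [even_coordSum_iff_of_adj]
  rw [← card_evenPart_add_card_oddPart, heven, hodd, add_comm]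

/-! ### The isoperimetric inequality and its near-equality case -/

theorem four_mul_card_le_semiperimeter_sq (S : Finset (ℤ × ℤ)) :
    4 * #S ≤ semiperimeter S ^ 2 := by
  calc 4 * #S ≤ 4 * (#(S.image coordDiff) * #(S.image coordSum)) := by
        gcongr; exact card_le_card_image_mul_card_image S
    _ ≤ semiperimeter S ^ 2 := by
        rw [← mul_assoc]; exact four_mul_le_sq_add _ _

theorem card_add_semiperimeter_lt_card_sdiff_add_card {S : Finset (ℤ × ℤ)} (T : Finset (ℤ × ℤ))
    (hS : S.Nonempty) : #S + semiperimeter S < #(neighborSumset S \ T) + #T := by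
  have h1 := card_add_semiperimeter_lt_card_neighborSumset hS
  have h2 := le_card_sdiff T (neighborSumset S)
  omega

theorem semiperimeter_bounds {A : Finset (ℤ × ℤ)} (hA : A.Nonempty) :
    semiperimeter (evenPart A) + semiperimeter (oddPart A) + 2 ≤ #(neighborSumset A \ A) ∧
      #(evenPart A) + semiperimeter (evenPart A) < #(neighborSumset A \ A) + #(oddPart A) ∧
      #(oddPart A) + semiperimeter (oddPart A) < #(neighborSumset A \ A) + #(evenPart A) := by
  have hpos := hA.card_pos
  rw [← card_evenPart_add_card_oddPart A] at hpos
  have hempty : semiperimeter ∅ = 0 := rfl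
  rw [card_neighborSumset_sdiff]
  rcases (evenPart A).eq_empty_or_nonempty with hS | hS <;>
  rcases (oddPart A).eq_empty_or_nonempty with hT | hT
  · simp [hS, hT] at hpos
  · have := card_add_semiperimeter_lt_card_sdiff_add_card (evenPart A) hT
    simp only [hS, hempty, card_empty] at *
    omega
  · have := card_add_semiperimeter_lt_card_sdiff_add_card (oddPart A) hS
    simp only [hT, hempty, card_empty] at *
    omega
  · have := card_add_semiperimeter_lt_card_sdiff_add_card (oddPart A) hS
    have := card_add_semiperimeter_lt_card_sdiff_add_card (evenPart A) hT
    omega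

/-- Here and in the next two lemmas `(a, X)` and `(b, Y)` stand for the cardinality and the
semiperimeter of the two parity classes, and `w` for the size of the boundary minus two. -/
theorem eight_mul_add_le_of_far {X Y a b w : ℤ} (ha : 4 * a ≤ X ^ 2) (hb : 4 * b ≤ Y ^ 2)
    (hY : 0 ≤ Y) (hw : X + Y ≤ w) (haw : a + X ≤ w + b + 1) (h : Y + 3 ≤ X) :
    8 * (a + b) ≤ w ^ 2 ∧ (3 ≤ a + b → 8 * (a + b) + 1 < w ^ 2) := by
  obtain rfl | hY : Y = 0 ∨ 1 ≤ Y := by omega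
  · refine ⟨by nlinarith [sq_nonneg (w - 4)], fun hab => ?_⟩
    by_cases hw5 : w ≤ 5
    · have : w = 3 ∨ w = 4 ∨ w = 5 := by omega
      have : X = 3 ∨ X = 4 ∨ X = 5 := by omega
      grind
    · nlinarith
  · exact ⟨by nlinarith, fun _ => by nlinarith⟩

theorem eight_mul_add_le {X Y a b w : ℤ} (ha : 4 * a ≤ X ^ 2) (hb : 4 * b ≤ Y ^ 2) (hX : 0 ≤ X)
    (hY : 0 ≤ Y) (hw : X + Y ≤ w) (haw : a + X ≤ w + b + 1) (hbw : b + Y ≤ w + a + 1) :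
    8 * (a + b) ≤ w ^ 2 + 4 := by
  by_cases hXY : Y + 3 ≤ X
  · linarith [(eight_mul_add_le_of_far ha hb hY hw haw hXY).1]
  by_cases hYX : X + 3 ≤ Y
  · linarith [(eight_mul_add_le_of_far hb ha hX (by linarith) hbw hYX).1]
  have hnear : (X - Y) ^ 2 ≤ 4 := by nlinarith
  nlinarith

theorem near_and_eq_add_of_sq_le {X Y a b w : ℤ} (ha : 4 * a ≤ X ^ 2) (hb : 4 * b ≤ Y ^ 2)
    (hX : 0 ≤ X) (hY : 0 ≤ Y) (hw : X + Y ≤ w) (haw : a + X ≤ w + b + 1)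
    (hbw : b + Y ≤ w + a + 1) (hab : 3 ≤ a + b) (h : w ^ 2 ≤ 8 * (a + b) + 1) :
    (X - Y) ^ 2 ≤ 4 ∧ w = X + Y := by
  have hXY : ¬Y + 3 ≤ X := fun hXY =>
    h.not_gt ((eight_mul_add_le_of_far ha hb hY hw haw hXY).2 hab)
  have hYX : ¬X + 3 ≤ Y := fun hYX => by
    linarith [(eight_mul_add_le_of_far hb ha hX (by linarith) hbw hYX).2 (by linarith)]
  have hnear : (X - Y) ^ 2 ≤ 4 := by nlinarith
  refine ⟨hnear, hw.antisymm' ?_⟩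
  by_contra! hlt
  have hsum : X + Y ≤ 2 := by nlinarith
  nlinarith

theorem eight_mul_card_le {A : Finset (ℤ × ℤ)} (hA : A.Nonempty) :
    (8 * #A : ℤ) ≤ ((#(neighborSumset A \ A) : ℤ) - 2) ^ 2 + 4 := by
  obtain ⟨hsum, heven, hodd⟩ := semiperimeter_bounds hA
  have ha := four_mul_card_le_semiperimeter_sq (evenPart A)
  have hb := four_mul_card_le_semiperimeter_sq (oddPart A)
  rw [← card_evenPart_add_card_oddPart A]
  zify at *
  exact eight_mul_add_le ha hb (by positivity) (by positivity) (by linarith) (by linarith)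
    (by linarith)

/-- A set whose boundary exceeds the bound of `eight_mul_card_le` by so little that the set has to
be a box. The condition `3 ≤ #A` excludes small sets that have a single parity. -/
structure IsNearExtremal (A : Finset (ℤ × ℤ)) : Prop where
  three_le_card : 3 ≤ #A
  sq_le : ((#(neighborSumset A \ A) : ℤ) - 2) ^ 2 ≤ 8 * #A + 1

namespace IsNearExtremal

variable {A : Finset (ℤ × ℤ)}

theorem semiperimeter_eq (h : IsNearExtremal A) :
    ((semiperimeter (evenPart A) : ℤ) - semiperimeter (oddPart A)) ^ 2 ≤ 4 ∧
      #(neighborSumset A \ A) = semiperimeter (evenPart A) + semiperimeter (oddPart A) + 2 := by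
  obtain ⟨hsum, heven, hodd⟩ := semiperimeter_bounds
    (card_pos.1 (three_pos.trans_le h.three_le_card))
  have ha := four_mul_card_le_semiperimeter_sq (evenPart A)
  have hb := four_mul_card_le_semiperimeter_sq (oddPart A)
  obtain ⟨hA, h⟩ := h
  rw [← card_evenPart_add_card_oddPart A] at h hA
  zify at *
  obtain ⟨hnear, heq⟩ := near_and_eq_add_of_sq_le ha hb (by positivity) (by positivity)
    (by linarith) (by linarith) (by linarith) hA h
  exact ⟨hnear, by linarith⟩

theorem nonempty_parts (h : IsNearExtremal A) :
    (evenPart A).Nonempty ∧ (oddPart A).Nonempty := by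
  have hnear := (h.semiperimeter_eq).1
  have hempty : semiperimeter ∅ = 0 := rfl
  have ha := four_mul_card_le_semiperimeter_sq (evenPart A)
  have hb := four_mul_card_le_semiperimeter_sq (oddPart A)
  have hA := h.three_le_card
  rw [← card_evenPart_add_card_oddPart A] at hA
  zify at ha hb hA
  constructor <;> rw [nonempty_iff_ne_empty] <;> intro hS <;>
    simp only [hS, hempty, card_empty, Nat.cast_zero] at * <;> linarith

theorem card_parts_eq_mul (h : IsNearExtremal A) :
    #(evenPart A) = #((evenPart A).image coordDiff) * #((evenPart A).image coordSum) ∧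
      #(oddPart A) = #((oddPart A).image coordDiff) * #((oddPart A).image coordSum) := by
  obtain ⟨hnear, heq⟩ := h.semiperimeter_eq
  have ha := card_le_card_image_mul_card_image (evenPart A)
  have hb := card_le_card_image_mul_card_image (oddPart A)
  have hsq := h.sq_le
  rw [← card_evenPart_add_card_oddPart A, heq] at hsq
  unfold semiperimeter at hnear hsq
  zify at *
  have hslack : 8 * ((#((evenPart A).image coordDiff) : ℤ) * #((evenPart A).image coordSum) -
      #(evenPart A)) + 8 * (#((oddPart A).image coordDiff) * #((oddPart A).image coordSum) -
      #(oddPart A)) ≤ 5 := by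
    nlinarith [sq_nonneg ((#((evenPart A).image coordDiff) : ℤ) - #((evenPart A).image coordSum)),
      sq_nonneg ((#((oddPart A).image coordDiff) : ℤ) - #((oddPart A).image coordSum))]
  constructor <;> linarith

theorem card_neighborSumset_union_eq (h : IsNearExtremal A) :
    #(neighborSumset (evenPart A) ∪ oddPart A) =
        #(evenPart A) + semiperimeter (evenPart A) + 1 ∧
      #(neighborSumset (oddPart A) ∪ evenPart A) =
        #(oddPart A) + semiperimeter (oddPart A) + 1 := by
  have hcard := card_neighborSumset_sdiff A
  have heq := h.semiperimeter_eq.2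
  have heven := card_add_semiperimeter_lt_card_sdiff_add_card (oddPart A) h.nonempty_parts.1
  have hodd := card_add_semiperimeter_lt_card_sdiff_add_card (evenPart A) h.nonempty_parts.2
  rw [← card_sdiff_add_card, ← card_sdiff_add_card]
  omega

end IsNearExtremal

theorem subset_and_card_add_pair_le {S T : Finset (ℤ × ℤ)} (hS : S.Nonempty)
    (h : #(neighborSumset S ∪ T) = #S + semiperimeter S + 1) :
    T ⊆ neighborSumset S ∧ #(S.image coordDiff + {0, 2}) ≤ #(S.image coordDiff) + 1 ∧
      #(S.image coordSum + {0, 2}) ≤ #(S.image coordSum) + 1 := by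
  have hlt := card_add_semiperimeter_lt_card_neighborSumset hS
  have hT : neighborSumset S = neighborSumset S ∪ T :=
    eq_of_subset_of_card_le subset_union_left (by omega)
  have hd := card_add_card_image_coordDiff_le S
  have hs := card_add_card_image_coordSum_le S
  rw [← hT] at h
  unfold semiperimeter at h
  exact ⟨hT ▸ subset_union_right, by omega, by omega⟩

/-- The set of vertices whose rotated coordinates lie in `[u, u + N)` and `[v, v + M)`. -/
noncomputable def diagonalBox (u v : ℤ) (N M : ℕ) : Finset (ℤ × ℤ) :=
  (Ico u (u + N) ×ˢ Ico v (v + M)).preimage rotate rotate_injective.injOn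

theorem mem_diagonalBox {u v : ℤ} {N M : ℕ} {p : ℤ × ℤ} : p ∈ diagonalBox u v N M ↔
    coordDiff p ∈ Ico u (u + N) ∧ coordSum p ∈ Ico v (v + M) := by
  simp only [diagonalBox, mem_preimage, mem_product, rotate_apply]

theorem pred_or_succ_mem_image {S T : Finset (ℤ × ℤ)} (hST : S ⊆ neighborSumset T)
    (f : ℤ × ℤ → ℤ) (hf : ∀ p q, latticeGraph.Adj p q → f q = f p - 1 ∨ f q = f p + 1) :
    ∀ k ∈ S.image f, k - 1 ∈ T.image f ∨ k + 1 ∈ T.image f := by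
  simp only [forall_mem_image]
  intro p hp
  obtain ⟨q, hq, hpq⟩ := mem_neighborSumset.1 (hST hp)
  rcases hf p q hpq with h | h
  · exact .inl (h ▸ mem_image_of_mem f hq)
  · exact .inr (h ▸ mem_image_of_mem f hq)

theorem mem_iff_of_card_parts_eq_mul {A : Finset (ℤ × ℤ)}
    (hS : #(evenPart A) = #((evenPart A).image coordDiff) * #((evenPart A).image coordSum))
    (hT : #(oddPart A) = #((oddPart A).image coordDiff) * #((oddPart A).image coordSum))
    (p : ℤ × ℤ) :
    p ∈ A ↔ coordDiff p ∈ (evenPart A).image coordDiff ∪ (oddPart A).image coordDiff ∧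
      coordSum p ∈ (evenPart A).image coordSum ∪ (oddPart A).image coordSum := by
  have even_of_mem {q : ℤ × ℤ} (hq : q ∈ evenPart A) : Even (coordSum q) := (mem_filter.1 hq).2
  have odd_of_mem {q : ℤ × ℤ} (hq : q ∈ oddPart A) : ¬Even (coordSum q) := (mem_filter.1 hq).2
  constructor
  · intro hp
    by_cases he : Even (coordSum p)
    · have hpS : p ∈ evenPart A := mem_filter.2 ⟨hp, he⟩
      exact ⟨mem_union_left _ (mem_image_of_mem _ hpS), mem_union_left _ (mem_image_of_mem _ hpS)⟩
    · have hpT : p ∈ oddPart A := mem_filter.2 ⟨hp, he⟩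
      exact ⟨mem_union_right _ (mem_image_of_mem _ hpT), mem_union_right _ (mem_image_of_mem _ hpT)⟩
  · rintro ⟨hd, hs⟩
    by_cases he : Even (coordSum p)
    · have hpS : p ∈ evenPart A := mem_of_mem_image_of_card_eq hS
        (by grind [even_coordDiff_iff]) (by grind)
      exact mem_of_mem_filter p hpS
    · have hpT : p ∈ oddPart A := mem_of_mem_image_of_card_eq hT
        (by grind [even_coordDiff_iff]) (by grind)
      exact mem_of_mem_filter p hpT

theorem IsNearExtremal.exists_eq_diagonalBox {A : Finset (ℤ × ℤ)} (h : IsNearExtremal A) :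
    ∃ (u v : ℤ) (N M : ℕ), A = diagonalBox u v N M ∧ #(neighborSumset A \ A) = N + M + 2 := by
  obtain ⟨hS, hT⟩ := h.nonempty_parts
  obtain ⟨hTN, hdS, hsS⟩ := subset_and_card_add_pair_le hS h.card_neighborSumset_union_eq.1
  obtain ⟨hSN, hdT, hsT⟩ := subset_and_card_add_pair_le hT h.card_neighborSumset_union_eq.2
  have hd (p q) (hpq : latticeGraph.Adj p q) := (latticeGraph_adj_iff.1 hpq).1
  have hs (p q) (hpq : latticeGraph.Adj p q) := (latticeGraph_adj_iff.1 hpq).2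
  obtain ⟨u, hu⟩ := exists_union_eq_Ico (hS.image coordDiff) (hT.image coordDiff) hdS hdT
    (pred_or_succ_mem_image hSN coordDiff hd) (pred_or_succ_mem_image hTN coordDiff hd)
  obtain ⟨v, hv⟩ := exists_union_eq_Ico (hS.image coordSum) (hT.image coordSum) hsS hsT
    (pred_or_succ_mem_image hSN coordSum hs) (pred_or_succ_mem_image hTN coordSum hs)
  refine ⟨u, v, #((evenPart A).image coordDiff) + #((oddPart A).image coordDiff),
    #((evenPart A).image coordSum) + #((oddPart A).image coordSum), ?_, ?_⟩
  · ext p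
    rw [mem_diagonalBox, ← hu, ← hv]
    exact mem_iff_of_card_parts_eq_mul h.card_parts_eq_mul.1 h.card_parts_eq_mul.2 p
  · rw [h.semiperimeter_eq.2, semiperimeter, semiperimeter]
    omega

/-! ### Sizes and boundaries of boxes -/

theorem card_filter_even_add_Ico (u y : ℤ) (N : ℕ) :
    (#{x ∈ Ico u (u + N) | Even (x + y)} : ℤ) = (N + 1 - (u + y) % 2) / 2 := by
  induction N with
  | zero => simp; omega
  | succ N ih =>
    rw [Nat.cast_succ, ← add_assoc, ← insert_Ico_right_eq_Ico_add_one (by omega), filter_insert]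
    split_ifs with h
    · rw [card_insert_of_notMem (by simp), Nat.cast_succ, ih]
      rw [Int.even_iff] at h
      omega
    · rw [ih]
      rw [Int.even_iff] at h
      omega

theorem mem_range_rotate {z : ℤ × ℤ} : z ∈ Set.range rotate ↔ Even (z.1 + z.2) := by
  simp only [Set.mem_range, rotate_apply, coordDiff_apply, coordSum_apply, Prod.ext_iff,
    Prod.exists]
  constructor
  · rintro ⟨x, y, hd, hs⟩
    exact ⟨y, by omega⟩
  · rintro ⟨y, hy⟩
    exact ⟨z.2 - y, y, by omega, by omega⟩

theorem card_diagonalBox_eq_sum (u v : ℤ) (N M : ℕ) :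
    #(diagonalBox u v N M) = ∑ y ∈ Ico v (v + M), #{x ∈ Ico u (u + N) | Even (x + y)} := by
  classical
  rw [diagonalBox, card_preimage]
  simp only [mem_range_rotate, card_filter, sum_product_right]

theorem card_diagonalBox (u v : ℤ) (N M : ℕ) :
    (#(diagonalBox u v N M) : ℤ) = (N * M + 1 - (v - u) % 2) / 2 := by
  induction M with
  | zero => simp [card_diagonalBox_eq_sum]; omega
  | succ M ih =>
    rw [card_diagonalBox_eq_sum] at ih ⊢
    rw [Nat.cast_succ, ← add_assoc, ← insert_Ico_right_eq_Ico_add_one (by omega),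
      sum_insert (by simp), Nat.cast_add, ih, card_filter_even_add_Ico, mul_add_one]
    obtain ⟨n, rfl | rfl⟩ := N.even_or_odd'
    · push_cast
      rw [mul_assoc]
      omega
    · push_cast
      rw [add_mul, mul_assoc]
      omega

theorem union_neighborSumset_diagonalBox_subset (u v : ℤ) (N M : ℕ) :
    diagonalBox u v N M ∪ neighborSumset (diagonalBox u v N M) ⊆
      diagonalBox (u - 1) (v - 1) (N + 2) (M + 2) := by
  intro p hp
  simp only [mem_union, mem_neighborSumset, mem_diagonalBox, mem_Ico, latticeGraph_adj_iff] at hp ⊢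
  push_cast
  rcases hp with hp | ⟨q, hq, hpq⟩ <;> omega

theorem card_neighborSumset_diagonalBox_sdiff_le (u v : ℤ) (N M : ℕ) :
    #(neighborSumset (diagonalBox u v N M) \ diagonalBox u v N M) ≤ N + M + 2 := by
  have hsub := card_le_card (union_neighborSumset_diagonalBox_subset u v N M)
  have hbox := card_diagonalBox u v N M
  have hbig := card_diagonalBox (u - 1) (v - 1) (N + 2) (M + 2)
  have hmul : ((N + 2 : ℕ) : ℤ) * (M + 2 : ℕ) = N * M + 2 * N + 2 * M + 4 := by push_cast; ring
  rw [hmul] at hbig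
  rw [union_comm, ← card_sdiff_add_card] at hsub
  omega

theorem latticeBox_eq_diagonalBox (α β : ℕ) :
    latticeBox α β = diagonalBox 0 0 (α + 1) (β + 1) := by
  ext p
  simp only [mem_coe, mem_diagonalBox, mem_Ico, coordDiff_apply, coordSum_apply, latticeBox,
    Set.mem_ofPred_eq]
  push_cast
  omega

/-- Removing `R` may add the points of `R` to the boundary, but it takes as many points `f r` away
from it. -/
theorem encard_vertexBoundary_sdiff_le {V : Type*} {G : SimpleGraph V} {A R : Set V} (f : V → V)
    (hf : R.InjOn f) (hmaps : R.MapsTo f (vertexBoundary G A))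
    (hadj : ∀ r ∈ R, ∀ v ∈ A, G.Adj (f r) v → v ∈ R) :
    (vertexBoundary G (A \ R)).encard ≤ (vertexBoundary G A).encard := by
  have hsub : vertexBoundary G (A \ R) ⊆ (vertexBoundary G A \ f '' R) ∪ R := by
    rintro u ⟨hu, v, ⟨hvA, hvR⟩, huv⟩
    by_cases huR : u ∈ R
    · exact .inr huR
    · refine .inl ⟨⟨fun huA => hu ⟨huA, huR⟩, v, hvA, huv⟩, ?_⟩
      rintro ⟨r, hr, rfl⟩
      exact hvR (hadj r hr v hvA huv)
  calc (vertexBoundary G (A \ R)).encard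
      ≤ (vertexBoundary G A \ f '' R).encard + R.encard :=
        (Set.encard_le_encard hsub).trans (Set.encard_union_le _ _)
    _ = (vertexBoundary G A).encard := by
        rw [← hf.encard_image, Set.encard_sdiff_add_encard_of_subset hmaps.image_subset]

theorem add_two_le_encard_vertexBoundary {B : Set (ℤ × ℤ)} {k r : ℕ} (hB : B.encard = k)
    (h : ((r : ℤ) - 1) ^ 2 + 4 < 8 * k) :
    ((r + 2 : ℕ) : ℕ∞) ≤ (vertexBoundary latticeGraph B).encard := by
  lift B to Finset (ℤ × ℤ) using Set.finite_of_encard_eq_coe hB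
  rw [Set.encard_coe_eq_coe_finsetCard, Nat.cast_inj] at hB
  subst hB
  rw [vertexBoundary_coe, Set.encard_coe_eq_coe_finsetCard, Nat.cast_le]
  have hne : B.Nonempty := card_pos.1 (by zify; nlinarith)
  have hiso := eight_mul_card_le hne
  have hsum := (semiperimeter_bounds hne).1
  by_contra! hlt
  zify at hsum hlt
  nlinarith

theorem exists_eq_diagonalBox_of_encard_vertexBoundary_eq {B : Set (ℤ × ℤ)} {k r : ℕ}
    (hB : B.encard = k) (hk : 3 ≤ k) (hr : (r : ℤ) ^ 2 ≤ 8 * k + 1)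
    (h : (vertexBoundary latticeGraph B).encard = (r + 2 : ℕ)) :
    ∃ (u v : ℤ) (N M : ℕ), B = diagonalBox u v N M ∧ N + M = r := by
  lift B to Finset (ℤ × ℤ) using Set.finite_of_encard_eq_coe hB
  rw [Set.encard_coe_eq_coe_finsetCard, Nat.cast_inj] at hB
  subst hB
  rw [vertexBoundary_coe, Set.encard_coe_eq_coe_finsetCard, Nat.cast_inj] at h
  obtain ⟨u, v, N, M, hbox, hcard⟩ := IsNearExtremal.exists_eq_diagonalBox
    ⟨hk, by rw [h]; push_cast; linarith⟩
  exact ⟨u, v, N, M, by rw [← hbox], by omega⟩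

/-- The box of side lengths `N` and `M` at the origin with the `j` first vertices of its lowest
row removed. -/
noncomputable def truncatedBox (N M j : ℕ) : Finset (ℤ × ℤ) :=
  diagonalBox 0 0 N M \ diagonalBox 0 0 (2 * j) 1

theorem diagonalBox_one_subset {N M j : ℕ} (hj : 2 * j ≤ N + 1) (hM : 1 ≤ M) :
    diagonalBox 0 0 (2 * j) 1 ⊆ diagonalBox 0 0 N M := by
  intro p
  simp only [mem_diagonalBox, mem_Ico, coordDiff_apply, coordSum_apply]
  omega

theorem card_truncatedBox {N M j : ℕ} (hj : 2 * j ≤ N + 1) (hM : 1 ≤ M) :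
    #(truncatedBox N M j) = (N * M + 1) / 2 - j := by
  have hbox := card_diagonalBox 0 0 N M
  have hrow := card_diagonalBox 0 0 (2 * j) 1
  rw [truncatedBox, card_sdiff_of_subset (diagonalBox_one_subset hj hM)]
  push_cast at hrow
  omega

theorem encard_vertexBoundary_diagonalBox_le (u v : ℤ) (N M : ℕ) :
    (vertexBoundary latticeGraph (diagonalBox u v N M)).encard ≤ (N + M + 2 : ℕ) := by
  rw [vertexBoundary_coe, Set.encard_coe_eq_coe_finsetCard, Nat.cast_le]
  exact card_neighborSumset_diagonalBox_sdiff_le u v N M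

theorem encard_vertexBoundary_truncatedBox_le {N M j : ℕ} (hj : 2 * j ≤ N + 1) (hM : 1 ≤ M) :
    (vertexBoundary latticeGraph (truncatedBox N M j)).encard ≤ (N + M + 2 : ℕ) := by
  rw [truncatedBox, coe_sdiff]
  refine le_trans ?_ (encard_vertexBoundary_diagonalBox_le 0 0 N M)
  refine encard_vertexBoundary_sdiff_le (· + (0, -1)) (add_left_injective _).injOn ?_ ?_
  · refine fun p hp => ⟨?_, p, diagonalBox_one_subset hj hM hp, ?_⟩
    all_goals
      simp only [mem_coe, mem_diagonalBox, mem_Ico, latticeGraph_adj_iff, coordDiff_apply,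
        coordSum_apply, Prod.fst_add, Prod.snd_add] at hp ⊢
      omega
  · intro p hp q hq hpq
    simp only [mem_coe, mem_diagonalBox, mem_Ico, latticeGraph_adj_iff, coordDiff_apply,
      coordSum_apply, Prod.fst_add, Prod.snd_add] at hp hq hpq ⊢
    omega

/-! ### Congruences and minimal sets -/

section Congruence

variable {V : Type*} {G : SimpleGraph V} {A B C : Set V}

theorem congruentSets_of_mem_iff (φ : G ≃g G) (h : ∀ p, p ∈ A ↔ φ p ∈ B) : CongruentSets G A B :=
  ⟨φ, by rw [show A = φ ⁻¹' B from Set.ext h, Set.image_preimage_eq B φ.surjective]⟩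

theorem CongruentSets.symm (h : CongruentSets G A B) : CongruentSets G B A := by
  obtain ⟨φ, rfl⟩ := h
  exact ⟨φ.symm, by simp [Set.image_image]⟩

theorem CongruentSets.trans (h : CongruentSets G A B) (h' : CongruentSets G B C) :
    CongruentSets G A C := by
  obtain ⟨φ, rfl⟩ := h
  obtain ⟨ψ, rfl⟩ := h'
  exact ⟨φ.trans ψ, by simp [Set.image_image]⟩

theorem image_vertexBoundary (φ : G ≃g G) (A : Set V) :
    φ '' vertexBoundary G A = vertexBoundary G (φ '' A) := by
  ext u
  obtain ⟨u, rfl⟩ := φ.surjective u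
  simp only [vertexBoundary, φ.injective.mem_set_image, Set.mem_ofPred_eq, Set.exists_mem_image,
    φ.map_adj_iff]

theorem CongruentSets.encard_eq (h : CongruentSets G A B) : A.encard = B.encard := by
  obtain ⟨φ, rfl⟩ := h
  exact (φ.injective.encard_image A).symm

theorem CongruentSets.encard_vertexBoundary_eq (h : CongruentSets G A B) :
    (vertexBoundary G A).encard = (vertexBoundary G B).encard := by
  obtain ⟨φ, rfl⟩ := h
  exact CongruentSets.encard_eq ⟨φ, image_vertexBoundary φ A⟩

theorem CongruentSets.isUniquelyMinimal (h : CongruentSets G A B) (hB : IsUniquelyMinimal G B) :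
    IsUniquelyMinimal G A := by
  refine ⟨fun C hC => ?_, fun C hC hcard => ?_⟩
  · rw [h.encard_vertexBoundary_eq]
    exact hB.1 C (hC.trans h.encard_eq)
  · exact (hB.2 C hC (hcard.trans h.encard_eq)).trans h.symm

end Congruence

/-- The `ℓ¹`-distance of two vertices of the lattice. -/
def l1Dist (p q : ℤ × ℤ) : ℤ := |p.1 - q.1| + |p.2 - q.2|

theorem l1Dist_eq_max (p q : ℤ × ℤ) :
    l1Dist p q = max |coordDiff p - coordDiff q| |coordSum p - coordSum q| := by
  simp only [l1Dist, coordDiff_apply, coordSum_apply]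
  grind

theorem l1Dist_triangle (p q r : ℤ × ℤ) : l1Dist p r ≤ l1Dist p q + l1Dist q r := by
  simp only [l1Dist]
  grind

theorem exists_adj_l1Dist_eq {p q : ℤ × ℤ} (h : p ≠ q) :
    ∃ r, latticeGraph.Adj p r ∧ l1Dist p q = l1Dist r q + 1 := by
  obtain ⟨x, y⟩ := p
  obtain ⟨a, b⟩ := q
  have habs_add {z w : ℤ} (hzw : z < w) : |z - w| = |z + 1 - w| + 1 := by grind
  have habs_sub {z w : ℤ} (hwz : w < z) : |z - w| = |z - 1 - w| + 1 := by grind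
  simp only [latticeGraph_adj_iff, coordDiff_apply, coordSum_apply, l1Dist]
  rcases lt_trichotomy x a with hx | hx | hx
  · exact ⟨(x + 1, y), by omega, by rw [habs_add hx, add_right_comm]⟩
  · rcases lt_trichotomy y b with hy | hy | hy
    · exact ⟨(x, y + 1), by omega, by rw [habs_add hy, add_assoc]⟩
    · exact absurd (Prod.ext hx hy) h
    · exact ⟨(x, y - 1), by omega, by rw [habs_sub hy, add_assoc]⟩
  · exact ⟨(x - 1, y), by omega, by rw [habs_sub hx, add_right_comm]⟩

theorem l1Dist_map_le (φ : latticeGraph ≃g latticeGraph) (p q : ℤ × ℤ) :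
    l1Dist (φ p) (φ q) ≤ l1Dist p q := by
  obtain ⟨n, hn⟩ := Int.eq_ofNat_of_zero_le (show 0 ≤ l1Dist p q by unfold l1Dist; positivity)
  induction n generalizing p with
  | zero =>
    obtain rfl : p = q := by unfold l1Dist at hn; grind
    simp [l1Dist]
  | succ n ih =>
    have hpq : p ≠ q := by
      rintro rfl
      simp only [l1Dist, sub_self, abs_zero] at hn
      omega
    obtain ⟨r, hpr, hr⟩ := exists_adj_l1Dist_eq hpq
    have hφ : l1Dist (φ p) (φ r) = 1 := φ.map_adj_iff.2 hpr
    have := l1Dist_triangle (φ p) (φ r) (φ q)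
    have := ih r (by omega)
    omega

theorem not_congruentSets_of_l1Dist_lt {A B : Set (ℤ × ℤ)} {p q : ℤ × ℤ} (hp : p ∈ B) (hq : q ∈ B)
    (h : ∀ x ∈ A, ∀ y ∈ A, l1Dist x y < l1Dist p q) : ¬CongruentSets latticeGraph A B := by
  rintro ⟨φ, rfl⟩
  obtain ⟨x, hx, rfl⟩ := hp
  obtain ⟨y, hy, rfl⟩ := hq
  exact (h x hx y hy).not_ge (l1Dist_map_le φ x y)

/-- The translation by `a` as an automorphism of the lattice graph. -/
def translation (a : ℤ × ℤ) : latticeGraph ≃g latticeGraph where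
  toEquiv := Equiv.addRight a
  map_rel_iff' := by simp [latticeGraph]

/-- The reflection exchanging the coordinates as an automorphism of the lattice graph. -/
def swapIso : latticeGraph ≃g latticeGraph where
  toEquiv := Equiv.prodComm ℤ ℤ
  map_rel_iff' := by simp [latticeGraph, add_comm]

/-- The reflection negating the first coordinate as an automorphism of the lattice graph. -/
def negFstIso : latticeGraph ≃g latticeGraph where
  toEquiv := (Equiv.neg ℤ).prodCongr (Equiv.refl ℤ)
  map_rel_iff' := by simp [latticeGraph, neg_add_eq_sub, abs_sub_comm]

theorem translation_apply (a p : ℤ × ℤ) : translation a p = p + a := rfl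

theorem swapIso_apply (p : ℤ × ℤ) : swapIso p = p.swap := rfl

theorem negFstIso_apply (p : ℤ × ℤ) : negFstIso p = (-p.1, p.2) := rfl

theorem congruentSets_diagonalBox_neg_diff (u v : ℤ) (N M : ℕ) :
    CongruentSets latticeGraph (diagonalBox u v N M) (diagonalBox (1 - u - N) v N M) := by
  refine congruentSets_of_mem_iff swapIso fun p => ?_
  simp only [mem_coe, mem_diagonalBox, mem_Ico, coordDiff_apply, coordSum_apply, swapIso_apply,
    Prod.fst_swap, Prod.snd_swap]
  omega

theorem congruentSets_diagonalBox_comm (u v : ℤ) (N M : ℕ) :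
    CongruentSets latticeGraph (diagonalBox u v N M) (diagonalBox v u M N) := by
  refine congruentSets_of_mem_iff negFstIso fun p => ?_
  simp only [mem_coe, mem_diagonalBox, mem_Ico, coordDiff_apply, coordSum_apply, negFstIso_apply]
  omega

theorem congruentSets_diagonalBox_zero_of_even {u v : ℤ} (N M : ℕ) (h : Even (v - u)) :
    CongruentSets latticeGraph (diagonalBox u v N M) (diagonalBox 0 0 N M) := by
  obtain ⟨x, hx⟩ := h
  refine congruentSets_of_mem_iff (translation (-x, x - v)) fun p => ?_
  simp only [mem_coe, mem_diagonalBox, mem_Ico, coordDiff_apply, coordSum_apply, translation_apply,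
    Prod.fst_add, Prod.snd_add]
  omega

theorem congruentSets_diagonalBox_zero_of_even_left (u v : ℤ) {N : ℕ} (M : ℕ) (hN : Even N) :
    CongruentSets latticeGraph (diagonalBox u v N M) (diagonalBox 0 0 N M) := by
  by_cases huv : Even (v - u)
  · exact congruentSets_diagonalBox_zero_of_even N M huv
  · refine (congruentSets_diagonalBox_neg_diff u v N M).trans
      (congruentSets_diagonalBox_zero_of_even N M ?_)
    grind

theorem congruentSets_diagonalBox_zero_of_even_right (u v : ℤ) (N : ℕ) {M : ℕ} (hM : Even M) :
    CongruentSets latticeGraph (diagonalBox u v N M) (diagonalBox 0 0 N M) :=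
  ((congruentSets_diagonalBox_comm u v N M).trans
    (congruentSets_diagonalBox_zero_of_even_left v u N hM)).trans
    (congruentSets_diagonalBox_comm 0 0 M N)

theorem isMinimalSet_of_encard_vertexBoundary_le {A : Set (ℤ × ℤ)} {k r : ℕ} (hA : A.encard = k)
    (hr : ((r : ℤ) - 1) ^ 2 + 4 < 8 * k)
    (h : (vertexBoundary latticeGraph A).encard ≤ (r + 2 : ℕ)) : IsMinimalSet latticeGraph A :=
  fun _ hB => h.trans (add_two_le_encard_vertexBoundary (hB.trans hA) hr)

theorem isMinimalSet_diagonalBox {N M : ℕ}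
    (h : ((N + M : ℕ) - 1 : ℤ) ^ 2 + 4 < 8 * #(diagonalBox 0 0 N M)) :
    IsMinimalSet latticeGraph (diagonalBox 0 0 N M) :=
  isMinimalSet_of_encard_vertexBoundary_le (Set.encard_coe_eq_coe_finsetCard _) h
    (encard_vertexBoundary_diagonalBox_le 0 0 N M)

theorem isUniquelyMinimal_diagonalBox {N M k : ℕ} (hk : #(diagonalBox 0 0 N M) = k)
    (hk3 : 3 ≤ k) (hlow : ((N + M : ℕ) - 1 : ℤ) ^ 2 + 4 < 8 * k)
    (hhigh : ((N + M : ℕ) : ℤ) ^ 2 ≤ 8 * k + 1)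
    (hboxes : ∀ (u v : ℤ) (N' M' : ℕ), N' + M' = N + M → #(diagonalBox u v N' M') = k →
      CongruentSets latticeGraph (diagonalBox u v N' M') (diagonalBox 0 0 N M)) :
    IsUniquelyMinimal latticeGraph (diagonalBox 0 0 N M) := by
  refine ⟨isMinimalSet_diagonalBox (by rwa [hk]), fun B hB hcard => ?_⟩
  have hboundary : (vertexBoundary latticeGraph B).encard ≤ (N + M + 2 : ℕ) :=
    (hB _ hcard.symm).trans (encard_vertexBoundary_diagonalBox_le 0 0 N M)
  rw [Set.encard_coe_eq_coe_finsetCard, hk] at hcard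
  obtain ⟨u, v, N', M', rfl, hsum⟩ := exists_eq_diagonalBox_of_encard_vertexBoundary_eq hcard hk3
    hhigh (hboundary.antisymm (add_two_le_encard_vertexBoundary hcard hlow))
  rw [Set.encard_coe_eq_coe_finsetCard, Nat.cast_inj] at hcard
  exact hboxes u v N' M' hsum hcard

/-! ### The two families of uniquely minimal boxes -/

theorem card_diagonalBox_odd_square (n : ℕ) :
    #(diagonalBox 0 0 (2 * n + 1) (2 * n + 1)) = 2 * n ^ 2 + 2 * n + 1 := by
  have h := card_diagonalBox 0 0 (2 * n + 1) (2 * n + 1)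
  have hmul : ((2 * n + 1 : ℕ) : ℤ) * (2 * n + 1 : ℕ) + 1 = 2 * (2 * n ^ 2 + 2 * n + 1) := by
    push_cast
    ring
  rw [hmul] at h
  zify
  omega

theorem two_mul_card_diagonalBox_succ (n : ℕ) :
    2 * #(diagonalBox 0 0 n (n + 1)) = n * (n + 1) := by
  have h := card_diagonalBox 0 0 n (n + 1)
  have heven := Nat.even_mul_succ_self n
  rw [Nat.even_iff] at heven
  norm_cast at h
  omega

theorem latticeBox_zero_zero : latticeBox 0 0 = {(0, 0)} := by
  ext ⟨x, y⟩
  simp only [latticeBox, Set.mem_ofPred_eq, Set.mem_singleton_iff, Prod.mk.injEq]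
  omega

theorem latticeBox_zero_one : latticeBox 0 1 = latticeBox 0 0 := by
  ext p
  simp only [latticeBox, Set.mem_ofPred_eq]
  omega

theorem isUniquelyMinimal_latticeBox_zero_zero :
    IsUniquelyMinimal latticeGraph (latticeBox 0 0) := by
  constructor
  · rw [latticeBox_eq_diagonalBox]
    have hcard := card_diagonalBox_odd_square 0
    exact isMinimalSet_diagonalBox (by rw [hcard]; norm_num)
  · intro B _ hcard
    rw [latticeBox_zero_zero] at hcard ⊢
    obtain ⟨p, rfl⟩ := Set.encard_eq_one.1 (hcard.trans (Set.encard_singleton _))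
    exact ⟨translation (-p), by rw [Set.image_singleton, translation_apply, add_neg_cancel]; rfl⟩

theorem isUniquelyMinimal_latticeBox_even (n : ℕ) :
    IsUniquelyMinimal latticeGraph (latticeBox (2 * n) (2 * n)) := by
  rcases n.eq_zero_or_pos with rfl | hn
  · exact isUniquelyMinimal_latticeBox_zero_zero
  rw [latticeBox_eq_diagonalBox]
  refine isUniquelyMinimal_diagonalBox (card_diagonalBox_odd_square n) (by nlinarith)
    (by push_cast; nlinarith) (by push_cast; nlinarith) fun u v N M hsum hcard => ?_
  have hbox := card_diagonalBox u v N M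
  rw [hcard] at hbox
  push_cast at hbox
  obtain ⟨d, hN⟩ : ∃ d : ℤ, (N : ℤ) = 2 * n + 1 + d := ⟨N - (2 * n + 1), by ring⟩
  have hM : (M : ℤ) = 2 * n + 1 - d := by omega
  have hmul : (N : ℤ) * M + 1 = 2 * (2 * n ^ 2 + 2 * n + 1) - d ^ 2 := by rw [hN, hM]; ring
  rw [hmul] at hbox
  have hd : d = 0 := by nlinarith [show d ^ 2 ≤ 0 by omega]
  rw [hd] at hbox
  obtain rfl : N = 2 * n + 1 := by omega
  obtain rfl : M = 2 * n + 1 := by omega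
  exact congruentSets_diagonalBox_zero_of_even _ _ (Int.even_iff.2 (by omega))

theorem isUniquelyMinimal_latticeBox_succ (n : ℕ) :
    IsUniquelyMinimal latticeGraph (latticeBox n (n + 1)) := by
  rcases n.eq_zero_or_pos with rfl | hn
  · rw [zero_add, latticeBox_zero_one]
    exact isUniquelyMinimal_latticeBox_zero_zero
  rw [latticeBox_eq_diagonalBox]
  have hk := two_mul_card_diagonalBox_succ (n + 1)
  refine isUniquelyMinimal_diagonalBox rfl (by nlinarith)
    (by zify at hk; push_cast; nlinarith) (by zify at hk; push_cast; nlinarith)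
    fun u v N M hsum hcard => ?_
  have hbox := card_diagonalBox u v N M
  rw [hcard] at hbox
  obtain ⟨d, hN⟩ : ∃ d : ℤ, (N : ℤ) = n + 1 + d := ⟨N - (n + 1), by ring⟩
  have hM : (M : ℤ) = n + 2 - d := by omega
  have hmul : (N : ℤ) * M = (n + 1) * (n + 1 + 1) - d * (d - 1) := by rw [hN, hM]; ring
  rw [hmul] at hbox
  zify at hk
  have hd : d * (d - 1) ≤ 1 := by omega
  have hd' : d = 0 ∨ d = 1 := by
    have : -1 < d := by nlinarith
    have : d < 2 := by nlinarith
    omega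
  have hcongr : CongruentSets latticeGraph (diagonalBox u v N M) (diagonalBox 0 0 N M) := by
    rcases (by grind : Even N ∨ Even M) with heven | heven
    · exact congruentSets_diagonalBox_zero_of_even_left u v M heven
    · exact congruentSets_diagonalBox_zero_of_even_right u v N heven
  rcases hd' with hd' | hd'
  · obtain rfl : N = n + 1 := by omega
    obtain rfl : M = n + 1 + 1 := by omega
    exact hcongr
  · obtain rfl : N = n + 1 + 1 := by omega
    obtain rfl : M = n + 1 := by omega
    exact hcongr.trans (congruentSets_diagonalBox_comm 0 0 _ _)

/-! ### The remaining sizes -/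

theorem not_congruentSets_truncatedBox {N M N' M' j j' : ℕ} (hN : N < M') (hM : M < M')
    (hM' : 2 ≤ M') (hj' : 2 * j' < N') (hparity : M' % 2 = 1 ∨ 2 ≤ N') :
    ¬CongruentSets latticeGraph (truncatedBox N M j) (truncatedBox N' M' j') := by
  have hp : ((-j' : ℤ), (j' : ℤ)) ∈ truncatedBox N' M' j' := by
    simp only [truncatedBox, mem_sdiff, mem_diagonalBox, mem_Ico, coordDiff_apply, coordSum_apply]
    omega
  have hq : (((M' - 1) / 2 : ℤ), (M' / 2 : ℤ)) ∈ truncatedBox N' M' j' := by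
    simp only [truncatedBox, mem_sdiff, mem_diagonalBox, mem_Ico, coordDiff_apply, coordSum_apply]
    omega
  refine not_congruentSets_of_l1Dist_lt hp hq fun x hx y hy => ?_
  simp only [truncatedBox, mem_coe, mem_sdiff, mem_diagonalBox, mem_Ico] at hx hy
  rw [l1Dist_eq_max, l1Dist_eq_max]
  refine lt_max_of_lt_right (lt_of_lt_of_le (b := (M' - 1 : ℤ)) ?_ (le_abs.2 (.inr ?_)))
  · rw [max_lt_iff, abs_lt, abs_lt]
    omega
  · simp only [coordSum_apply]
    omega

theorem not_isUniquelyMinimal_of_truncatedBox {A : Set (ℤ × ℤ)} {k N M N' M' j j' : ℕ}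
    (hA : A.encard = k) (hlow : ((N + M : ℕ) - 1 : ℤ) ^ 2 + 4 < 8 * k)
    (hN : N < M') (hM : M < M') (hM0 : 1 ≤ M) (hsum : N + M = N' + M')
    (hparity : M' % 2 = 1 ∨ 2 ≤ N') (hj : 2 * j ≤ N + 1) (hj' : 2 * j' < N')
    (hk : (N * M + 1) / 2 = k + j) (hk' : (N' * M' + 1) / 2 = k + j') :
    ¬IsUniquelyMinimal latticeGraph A := by
  intro hU
  have hcard : (truncatedBox N M j : Set (ℤ × ℤ)).encard = k := by
    rw [Set.encard_coe_eq_coe_finsetCard, card_truncatedBox hj hM0, hk, Nat.add_sub_cancel]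
  have hcard' : (truncatedBox N' M' j' : Set (ℤ × ℤ)).encard = k := by
    rw [Set.encard_coe_eq_coe_finsetCard, card_truncatedBox (by omega) (by omega), hk',
      Nat.add_sub_cancel]
  have hmin := isMinimalSet_of_encard_vertexBoundary_le hcard hlow
    (encard_vertexBoundary_truncatedBox_le hj hM0)
  have hmin' := isMinimalSet_of_encard_vertexBoundary_le hcard' (hsum ▸ hlow)
    (encard_vertexBoundary_truncatedBox_le (by omega) (by omega))
  exact not_congruentSets_truncatedBox hN hM (by omega) hj' hparity
    ((hU.2 _ hmin (hcard.trans hA.symm)).trans (hU.2 _ hmin' (hcard'.trans hA.symm)).symm)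

theorem IsUniquelyMinimal.congruentSets_diagonalBox {A : Set (ℤ × ℤ)} {N M : ℕ}
    (hU : IsUniquelyMinimal latticeGraph A) (hA : A.encard = #(diagonalBox 0 0 N M))
    (hlow : ((N + M : ℕ) - 1 : ℤ) ^ 2 + 4 < 8 * #(diagonalBox 0 0 N M)) :
    CongruentSets latticeGraph A (diagonalBox 0 0 N M) :=
  (hU.2 _ (isMinimalSet_diagonalBox hlow) (by rw [hA, Set.encard_coe_eq_coe_finsetCard])).symm

theorem not_isUniquelyMinimal_of_sq_bounds_four_mul {A : Set (ℤ × ℤ)} {k n : ℕ}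
    (hA : A.encard = k) (hlow : (4 * n + 3 : ℤ) ^ 2 + 4 < 8 * k)
    (hhigh : (8 * k : ℤ) ≤ (4 * n + 4) ^ 2 + 4) : ¬IsUniquelyMinimal latticeGraph A := by
  have hsize : k ≤ 2 * (n + 1) ^ 2 := by zify; ring_nf at hhigh ⊢; omega
  obtain ⟨j, hj⟩ := Nat.exists_eq_add_of_le hsize
  have hjn : j ≤ n := by zify at hj; ring_nf at hlow hj; omega
  refine not_isUniquelyMinimal_of_truncatedBox (N := 2 * n + 2) (M := 2 * n + 2)
    (N' := 2 * n + 1) (M' := 2 * n + 3) (j := j) (j' := j) hA ?_ (by omega) (by omega) (by omega)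
    (by omega) (by omega) (by omega) (by omega) ?_ ?_
  · push_cast
    linarith
  · rw [← hj]
    ring_nf
    omega
  · rw [← hj]
    ring_nf
    omega

theorem IsUniquelyMinimal.congruentSets_latticeBox_even {A : Set (ℤ × ℤ)} {k n : ℕ}
    (hU : IsUniquelyMinimal latticeGraph A) (hA : A.encard = k)
    (hlow : (4 * n + 1 : ℤ) ^ 2 + 4 < 8 * k) (hhigh : (8 * k : ℤ) ≤ (4 * n + 2) ^ 2 + 4) :
    CongruentSets latticeGraph A (latticeBox (2 * n) (2 * n)) := by
  have hsize : k ≤ 2 * n ^ 2 + 2 * n + 1 := by zify; linarith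
  rcases hsize.eq_or_lt with rfl | hlt
  · rw [latticeBox_eq_diagonalBox]
    refine hU.congruentSets_diagonalBox (by rw [hA, card_diagonalBox_odd_square]) ?_
    rw [card_diagonalBox_odd_square]
    push_cast
    nlinarith
  · obtain ⟨j, hj⟩ := Nat.exists_eq_add_of_le (Nat.le_of_lt_succ hlt)
    have hjn : 2 * j < 2 * n := by zify at hj ⊢; linarith
    refine absurd hU (not_isUniquelyMinimal_of_truncatedBox (N := 2 * n + 1) (M := 2 * n + 1)
      (N' := 2 * n) (M' := 2 * n + 2) (j := j + 1) (j' := j) hA ?_ (by omega) (by omega)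
      (by omega) (by omega) (by omega) (by omega) hjn ?_ ?_)
    · push_cast
      linarith
    · rw [← add_assoc, ← hj]
      ring_nf
      omega
    · rw [← hj]
      ring_nf
      omega

theorem IsUniquelyMinimal.congruentSets_latticeBox_succ {A : Set (ℤ × ℤ)} {k n : ℕ}
    (hU : IsUniquelyMinimal latticeGraph A) (hA : A.encard = k)
    (hlow : (2 * n + 2 : ℤ) ^ 2 + 4 < 8 * k) (hhigh : (8 * k : ℤ) ≤ (2 * n + 3) ^ 2 + 4) :
    CongruentSets latticeGraph A (latticeBox n (n + 1)) := by
  have hbox := two_mul_card_diagonalBox_succ (n + 1)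
  rw [latticeBox_eq_diagonalBox]
  generalize hm : #(diagonalBox 0 0 (n + 1) (n + 1 + 1)) = m at hbox
  zify at hbox
  have hsize : k ≤ m := by ring_nf at hhigh hbox; omega
  rcases hsize.eq_or_lt with rfl | hlt
  · refine hU.congruentSets_diagonalBox (by rw [hA, hm]) ?_
    rw [hm]
    push_cast
    linarith
  · obtain ⟨j, rfl⟩ := Nat.exists_eq_add_of_le hlt
    push_cast at hbox
    have hjn : 2 * j + 2 < n := by zify; linarith
    refine absurd hU (not_isUniquelyMinimal_of_truncatedBox (N := n + 1) (M := n + 2)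
      (N' := n) (M' := n + 3) (j := j + 1) (j' := j) hA ?_ (by omega) (by omega)
      (by omega) (by omega) (by omega) (by omega) (by omega) ?_ ?_)
    · push_cast
      linarith
    · have : (n + 1) * (n + 2) = 2 * (k + (j + 1)) := by zify; linarith
      omega
    · have : n * (n + 3) = 2 * (k + j) := by zify; linarith
      omega

theorem exists_sq_bounds {k : ℕ} (hk : 1 ≤ k) :
    ∃ r : ℕ, 2 ≤ r ∧ ((r : ℤ) - 1) ^ 2 + 4 < 8 * k ∧ (8 * k : ℤ) ≤ r ^ 2 + 4 := by
  have hex : ∃ s : ℕ, 8 * k ≤ (s + 2) ^ 2 + 4 := ⟨8 * k, by nlinarith⟩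
  refine ⟨Nat.find hex + 2, by omega, ?_, mod_cast Nat.find_spec hex⟩
  rcases h : Nat.find hex with _ | s
  · push_cast
    linarith
  · have hlt := Nat.find_min hex (m := s) (by omega)
    push Not at hlt
    zify at hlt
    push_cast
    linarith

theorem exists_congruentSets_latticeBox {A : Set (ℤ × ℤ)} (hfin : A.Finite) (hne : A.Nonempty)
    (hU : IsUniquelyMinimal latticeGraph A) :
    ∃ n : ℕ, CongruentSets latticeGraph A (latticeBox (2 * n) (2 * n)) ∨
      CongruentSets latticeGraph A (latticeBox n (n + 1)) := by
  obtain ⟨k, hk⟩ := hfin.exists_encard_eq_coe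
  have hk1 : 1 ≤ k := by
    rw [← Nat.cast_le (α := ℕ∞), ← hk]
    exact Set.one_le_encard_iff_nonempty.2 hne
  obtain ⟨r, hr, hlow, hhigh⟩ := exists_sq_bounds hk1
  obtain ⟨n, rfl | rfl | rfl⟩ : ∃ n, r = 4 * n + 2 ∨ r = 4 * n + 4 ∨ r = 2 * n + 3 := by
    rcases (by omega : r % 4 = 2 ∨ r % 4 = 0 ∨ r % 2 = 1) with h | h | h
    · exact ⟨r / 4, by omega⟩
    · exact ⟨r / 4 - 1, by omega⟩
    · exact ⟨(r - 3) / 2, by omega⟩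
  all_goals push_cast at hlow hhigh; ring_nf at hlow hhigh
  · exact ⟨n, .inl (hU.congruentSets_latticeBox_even hk (by linarith) (by linarith))⟩
  · exact absurd hU
      (not_isUniquelyMinimal_of_sq_bounds_four_mul hk (n := n) (by linarith) (by linarith))
  · exact ⟨n, .inr (hU.congruentSets_latticeBox_succ hk (by linarith) (by linarith))⟩

theorem theoremB (A : Set (ℤ × ℤ)) (hfin : A.Finite) (hne : A.Nonempty) :
    IsUniquelyMinimal latticeGraph A ↔
      ∃ n : ℕ, CongruentSets latticeGraph A (latticeBox (2 * n) (2 * n)) ∨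
        CongruentSets latticeGraph A (latticeBox n (n + 1)) := by
  refine ⟨exists_congruentSets_latticeBox hfin hne, ?_⟩
  rintro ⟨n, h | h⟩
  · exact h.isUniquelyMinimal (isUniquelyMinimal_latticeBox_even n)
  · exact h.isUniquelyMinimal (isUniquelyMinimal_latticeBox_succ n)
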